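/- Let $F$ be a field of arbitrary characteristic. For $\alpha,\beta\in F^\times$ let $O_{\alpha,\beta}$ be the $F$-algebra with basis $\{\tilde z_a : 0\neq a\in(\mathbb{Z}/3)^2\}$ and product, for $a=(i,j)$, $b=(i',j')$ with $0\le i,j,i',j'\le 2$ and $\Delta = ij'-ji' \bmod 3$, \[ \tilde z_a * \tilde z_b=\begin{cases}0 & \text{if } \Delta=2 \text{ or } a+b=0,\\ -\alpha^{\lfloor (i+i')/3\rfloor}\beta^{\lfloor (j+j')/3\rfloor}\,\tilde z_{a+b} & \text{if } \Delta=1,\\ \alpha^{\lfloor (i+i')/3\rfloor}\beta^{\lfloor (j+j')/3\rfloor}\,\tilde z_{a+b} & \text{otherwise,}\end{cases} \] and with the quadratic form $\mathrm{n}$ (the norm) such that $\mathrm{n}(\tilde z_a)=0$ for all $a$ and whose polar form satisfies $\mathrm{n}(\tilde z_a,\tilde z_b)=\alpha^{\lfloor (i+i')/3\rfloor}\beta^{\lfloor (j+j')/3\rfloor}$ if $a+b=0$ and $\mathrm{n}(\tilde z_a,\tilde z_b)=0$ otherwise. The canonical grading $\Gamma_{\alpha,\beta}$ is the $(\mathbb{Z}/3)^2$-grading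 on $O_{\alpha,\beta}$ with $\deg \tilde z_a=a$ for all $a$. The algebra $O_{1,1}$ is the split Okubo algebra over $F$, and an Okubo algebra over $F$ is a twisted form of it: a (not necessarily associative or unital) $F$-algebra $O$ with a quadratic form that becomes isomorphic, as an algebra with quadratic form, to the split Okubo algebra over an algebraic closure $\overline F$ of $F$ after extending scalars to $\overline F$. A grading $\Gamma: O=\bigoplus_{g\in G} O_g$ (with $O_gO_h\subseteq O_{gh}$) by an abelian group $G$ is special if $O_e=0$. Two gradings $\Gamma: A=\bigoplus_{g\in G}A_g$ and $\Gamma': B=\bigoplus_{h\in H}B_h$ are equivalent if there is an isomorphism of algebras $\varphi:A\to B$ such that for every $g\in G$ with $A_g\neq 0$ there is $h\in H$ with $\varphi(A_g)=B_h$. Corollary. Let $\Gamma$ be a special grading by an abelian group on an Okubo algebra $O$ over $F$. Then there are nonzero $\alpha,\beta\in F$ such that $(O,\Gamma)$ is equivalent to $(O_{\alpha,\beta},\Gamma_{\alpha,\beta})$. -/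

import Mathlib

open scoped TensorProduct

namespace Okubo

/-- The index set `(ℤ/3)² ∖ {(0,0)}`. -/
abbrev Idx : Type := {a : ZMod 3 × ZMod 3 // a ≠ 0}

/-- The structure constant of `z_a * z_b` with respect to `z_{a+b}` in the `ℤ`-form of the split
Okubo algebra: with `Δ = det (a, b)`, it is `0` if `Δ = 2` or `a + b = 0`, it is `-1` if `Δ = 1`,
and it is `1` otherwise. -/
def sgn (a b : ZMod 3 × ZMod 3) : ℤ :=
  if a.1 * b.2 - a.2 * b.1 = 2 ∨ a + b = 0 then 0
  else if a.1 * b.2 - a.2 * b.1 = 1 then -1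
  else 1

/-- For `i, j ∈ ℤ/3` with representatives in `{0, 1, 2}`, the carry of the sum `i + j`. -/
def carry (i j : ZMod 3) : ℕ := (i.val + j.val) / 3

/-- The Okubo algebra `O_{α,β}` over `R`, as the free module with basis `z̃_a`, `a ∈ Idx`. An
element is identified with its family of coordinates. The product is given by
`z̃_a * z̃_b = sgn a b • α ^ (carry of the first entries) β ^ (carry of the second entries) z̃_{a+b}`
(which is `0` if `a + b = 0`): this is the product of the elements
`z̃_{i,j} = z_{i,j} ⊗ α^{i/3} β^{j/3}`, `0 ≤ i, j ≤ 2`. -/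
def OkuboAlg (R : Type*) (_α _β : R) : Type _ := Idx → R

namespace OkuboAlg

section

variable {R : Type*} [CommRing R] {α β : R}

instance : AddCommGroup (OkuboAlg R α β) := inferInstanceAs (AddCommGroup (Idx → R))

instance : Module R (OkuboAlg R α β) := inferInstanceAs (Module R (Idx → R))

/-- The coordinate of an element with respect to `z̃_c`. -/
def coord (c : Idx) : OkuboAlg R α β →ₗ[R] R := LinearMap.proj (R := R) (φ := fun _ : Idx => R) c

/-- The basis element `z̃_a`. -/
def z (a : Idx) : OkuboAlg R α β := (Pi.single a 1 : Idx → R)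

instance : Mul (OkuboAlg R α β) where
  mul x y := fun c : Idx => ∑ a : Idx, ∑ b : Idx,
    if a.val + b.val = c.val then
      (sgn a.val b.val : R) * α ^ carry a.val.1 b.val.1 * β ^ carry a.val.2 b.val.2
        * coord a x * coord b y
    else 0

theorem ext {x y : OkuboAlg R α β} (h : ∀ c, coord c x = coord c y) : x = y := funext h

theorem coord_mul (x y : OkuboAlg R α β) (c : Idx) :
    coord c (x * y) = ∑ a : Idx, ∑ b : Idx,
      if a.val + b.val = c.val then
        (sgn a.val b.val : R) * α ^ carry a.val.1 b.val.1 * β ^ carry a.val.2 b.val.2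
          * coord a x * coord b y
      else 0 := rfl

theorem coord_z (a c : Idx) : coord c (z a : OkuboAlg R α β) = if c = a then 1 else 0 :=
  Pi.single_apply a (1 : R) c

instance : NonUnitalNonAssocRing (OkuboAlg R α β) where
  left_distrib x y w := ext fun c => by
    simp only [coord_mul, map_add, ← Finset.sum_add_distrib]
    refine Finset.sum_congr rfl fun a _ => Finset.sum_congr rfl fun b _ => ?_
    split_ifs <;> ring
  right_distrib x y w := ext fun c => by
    simp only [coord_mul, map_add, ← Finset.sum_add_distrib]
    refine Finset.sum_congr rfl fun a _ => Finset.sum_congr rfl fun b _ => ?_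
    split_ifs <;> ring
  zero_mul x := ext fun c => by simp [coord_mul]
  mul_zero x := ext fun c => by simp [coord_mul]

instance : IsScalarTower R (OkuboAlg R α β) (OkuboAlg R α β) where
  smul_assoc r x y := ext fun c => by
    simp only [smul_eq_mul, coord_mul, map_smul, Finset.mul_sum]
    refine Finset.sum_congr rfl fun a _ => Finset.sum_congr rfl fun b _ => ?_
    split_ifs <;> ring

instance : SMulCommClass R (OkuboAlg R α β) (OkuboAlg R α β) where
  smul_comm r x y := ext fun c => by
    simp only [smul_eq_mul, coord_mul, map_smul, Finset.mul_sum]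
    refine Finset.sum_congr rfl fun a _ => Finset.sum_congr rfl fun b _ => ?_
    split_ifs <;> ring

end

/-- The norm of `O_{α,β}`: `n(z̃_a) = 0` for all `a`, and the polar form satisfies
`n(z̃_a, z̃_b) = 0` if `a + b ≠ 0`, while `n(z̃_a, z̃_{-a}) = α ^ (carry) β ^ (carry)`, that is,
`α` for `a = (1,0)`, `β` for `a = (0,1)`, and `α β` for `a = (1,1)` and `a = (1,2)`. -/
noncomputable def norm (R : Type*) [CommRing R] (α β : R) : QuadraticForm R (OkuboAlg R α β) :=
  α • QuadraticMap.linMulLin (coord ⟨(1, 0), by decide⟩) (coord ⟨(2, 0), by decide⟩)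
    + β • QuadraticMap.linMulLin (coord ⟨(0, 1), by decide⟩) (coord ⟨(0, 2), by decide⟩)
    + (α * β) • QuadraticMap.linMulLin (coord ⟨(1, 1), by decide⟩) (coord ⟨(2, 2), by decide⟩)
    + (α * β) • QuadraticMap.linMulLin (coord ⟨(1, 2), by decide⟩) (coord ⟨(2, 1), by decide⟩)

end OkuboAlg

/-- The split Okubo algebra over `R`. -/
abbrev SplitOkubo (R : Type*) [CommRing R] : Type _ := OkuboAlg R (1 : R) (1 : R)

/-- `(O, *, n)` is an Okubo algebra over `F`, i.e. a twisted form of the split Okubo algebra: over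
an algebraic closure `K` of `F` there is an isomorphism of `K`-algebras from `K ⊗ O` onto the split
Okubo algebra over `K`, which is an isometry for the `K`-extension of `n`. (A quadratic form on
`K ⊗ O` is the extension of `n` if and only if it restricts to `n` on `1 ⊗ O`, in every
characteristic, so that it is enough to compare the norms on `1 ⊗ O`.) -/
def IsOkuboAlgebra (F : Type*) [Field F] (O : Type*) [NonUnitalNonAssocRing O] [Module F O]
    [IsScalarTower F O O] [SMulCommClass F O O] (n : QuadraticForm F O) : Prop :=
  ∃ φ : (AlgebraicClosure F ⊗[F] O) ≃ₗ[AlgebraicClosure F] SplitOkubo (AlgebraicClosure F),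
    (∀ x y, φ (x * y) = φ x * φ y) ∧
    ∀ x : O, OkuboAlg.norm (AlgebraicClosure F) 1 1 (φ (1 ⊗ₜ[F] x))
      = algebraMap F (AlgebraicClosure F) (n x)

/-- A grading by the (additively written) abelian group `G` on the nonassociative `F`-algebra `A`:
a vector space decomposition `A = ⨁_{g ∈ G} A_g` with `A_g A_h ⊆ A_{g+h}`. -/
structure Grading (F : Type*) [Field F] (G : Type*) [AddCommGroup G] [DecidableEq G]
    (A : Type*) [NonUnitalNonAssocRing A] [Module F A] where
  /-- The homogeneous component of degree `g`. -/
  comp : G → Submodule F A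
  isInternal : DirectSum.IsInternal comp
  mul_mem : ∀ {g h : G} {x y : A}, x ∈ comp g → y ∈ comp h → x * y ∈ comp (g + h)

namespace Grading

variable {F : Type*} [Field F] {G : Type*} [AddCommGroup G] [DecidableEq G]
  {H : Type*} [AddCommGroup H] [DecidableEq H]
  {A : Type*} [NonUnitalNonAssocRing A] [Module F A]
  {B : Type*} [NonUnitalNonAssocRing B] [Module F B]

/-- A grading is special if the homogeneous component of the neutral element is trivial. -/
def IsSpecial (Γ : Grading F G A) : Prop := Γ.comp 0 = ⊥

/-- The support: the set of degrees of nonzero homogeneous components. -/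
def support (Γ : Grading F G A) : Set G := {g | Γ.comp g ≠ ⊥}

/-- Two gradings, by possibly different groups, are equivalent if there is an isomorphism of
algebras that sends each nonzero homogeneous component onto a homogeneous component. -/
def Equivalent (Γ : Grading F G A) (Γ' : Grading F H B) : Prop :=
  ∃ φ : A ≃ₗ[F] B, (∀ x y, φ (x * y) = φ x * φ y) ∧
    ∀ g ∈ Γ.support, ∃ h : H, (Γ.comp g).map (φ : A →ₗ[F] B) = Γ'.comp h

end Grading

section Canonical

variable {F : Type*} [Field F] (α β : F)

/-- The span of the basis elements `z̃_i` of degree `a`: it is `F z̃_a` if `a ≠ 0`, and `0` if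
`a = 0`. -/
def canonicalComp (a : ZMod 3 × ZMod 3) : Submodule F (OkuboAlg F α β) :=
  Submodule.span F (OkuboAlg.z '' {i : Idx | i.val = a})

theorem mem_canonicalComp {a : ZMod 3 × ZMod 3} {x : OkuboAlg F α β} :
    x ∈ canonicalComp α β a ↔ ∀ i : Idx, i.val ≠ a → OkuboAlg.coord i x = 0 := by
  constructor
  · intro hx i hi
    have : canonicalComp α β a ≤ LinearMap.ker (OkuboAlg.coord i) := by
      refine Submodule.span_le.2 ?_
      rintro _ ⟨j, hj, rfl⟩
      have : i ≠ j := fun h => hi (h ▸ hj)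
      simp [OkuboAlg.coord_z, this]
    exact this hx
  · intro h
    have hx : x = ∑ i : Idx, OkuboAlg.coord i x • OkuboAlg.z i := by
      refine OkuboAlg.ext fun c => ?_
      simp [OkuboAlg.coord_z]
    rw [hx]
    refine Submodule.sum_mem _ fun i _ => ?_
    by_cases hi : i.val = a
    · exact Submodule.smul_mem _ _ (Submodule.subset_span ⟨i, hi, rfl⟩)
    · simp [h i hi]

/-- The canonical `(ℤ/3)²`-grading on `O_{α,β}`, with `deg z̃_a = a`. -/
def canonicalGrading : Grading F (ZMod 3 × ZMod 3) (OkuboAlg F α β) where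
  comp := canonicalComp α β
  isInternal := by
    refine DirectSum.isInternal_submodule_of_iSupIndep_of_iSup_eq_top ?_ ?_
    · intro a
      rw [Submodule.disjoint_def]
      intro x hx hx'
      refine OkuboAlg.ext fun i => ?_
      rw [map_zero]
      by_cases hi : i.val = a
      · have : (⨆ (b) (_ : b ≠ a), canonicalComp α β b) ≤ LinearMap.ker (OkuboAlg.coord i) :=
          iSup₂_le fun b hb y hy =>
            (mem_canonicalComp α β).1 hy i fun h => hb (h.symm.trans hi)
        exact this hx'
      · exact (mem_canonicalComp α β).1 hx i hi
    · refine eq_top_iff.2 fun x _ => ?_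
      have hx : x = ∑ i : Idx, OkuboAlg.coord i x • OkuboAlg.z i := by
        refine OkuboAlg.ext fun c => ?_
        simp [OkuboAlg.coord_z]
      rw [hx]
      refine Submodule.sum_mem _ fun i _ => Submodule.smul_mem _ _ ?_
      exact Submodule.mem_iSup_of_mem i.val (Submodule.subset_span ⟨i, rfl, rfl⟩)
  mul_mem := by
    intro g h x y hx hy
    rw [mem_canonicalComp] at hx hy ⊢
    intro i hi
    rw [OkuboAlg.coord_mul]
    refine Finset.sum_eq_zero fun a _ => Finset.sum_eq_zero fun b _ => ?_
    split_ifs with hab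
    · by_cases ha : a.val = g
      · by_cases hb : b.val = h
        · exact absurd (by rw [← hab, ha, hb]) hi
        · simp [hy b hb]
      · simp [hx a ha]
    · rfl

end Canonical

end Okubo

namespace Okubo

/-! The argument uses only the identities `(x * y) * x = n(x) y = x * (y * x)`, nondegeneracy of the
polar form, and dimension 8. All three hold for the split algebra and descend from the algebraic
closure.

In a special grading, comparing degrees in these identities shows that components of degrees `g` and
`h` are orthogonal unless `g + h = 0`, that homogeneous elements are isotropic, and that a nonzero
homogeneous `x` has `x * x ≠ 0` and `n(x, x * x) ≠ 0`. The last fact forces `3 • g = 0` for every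
degree `g` of the support. It also makes the cubic form `n(x, x * x)` anisotropic on each component,
so over an algebraically closed field components have dimension at most one. This bound descends to
`F` (`IsOkuboAlgebra.exists_smul_eq`).

Two components `g` and `-g` cannot fill dimension 8, so there are nonzero homogeneous elements whose
degrees are independent over `ℤ/3`. Their products in the two orders cannot both be nonzero
(`IsOkuboAlgebra.mul_eq_zero_or`). Name them `e`, `f` so that `f * e = 0`. The linearized identities
then determine all products among the eight monomials of `canonicalFamily` from `α = n(e, e * e)`
and `β = n(f, f * f)` (`canonicalFamily_mul`), and the result is the table of `O_{α,β}`. -/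

/-- The identities `(x * y) * x = n(x) y = x * (y * x)` of a symmetric composition algebra,
together with nondegeneracy of the polar form of `n`. -/
structure IsSymmComp {E A : Type*} [Field E] [NonUnitalNonAssocRing A] [Module E A]
    (n : QuadraticForm E A) : Prop where
  mul_mul_self : ∀ x y : A, x * y * x = n x • y
  self_mul_mul : ∀ x y : A, x * (y * x) = n x • y
  nondeg : ∀ x : A, (∀ y, QuadraticMap.polar n x y = 0) → x = 0

/-! ### The split Okubo algebra is a symmetric composition algebra. -/

namespace OkuboAlg

theorem sum_idx {M : Type*} [AddCommMonoid M] (f : Idx → M) :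
    ∑ a, f a = f ⟨(0, 1), by decide⟩ + f ⟨(0, 2), by decide⟩ + f ⟨(1, 0), by decide⟩
      + f ⟨(1, 1), by decide⟩ + f ⟨(1, 2), by decide⟩ + f ⟨(2, 0), by decide⟩
      + f ⟨(2, 1), by decide⟩ + f ⟨(2, 2), by decide⟩ := by
  have h : (Finset.univ : Finset Idx) = {⟨(0, 1), by decide⟩, ⟨(0, 2), by decide⟩,
    ⟨(1, 0), by decide⟩, ⟨(1, 1), by decide⟩, ⟨(1, 2), by decide⟩, ⟨(2, 0), by decide⟩,
    ⟨(2, 1), by decide⟩, ⟨(2, 2), by decide⟩} := by decide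
  rw [h]
  repeat rw [Finset.sum_insert (by decide)]
  rw [Finset.sum_singleton]
  simp only [add_assoc]

theorem forall_idx {P : Idx → Prop} (h01 : P ⟨(0, 1), by decide⟩) (h02 : P ⟨(0, 2), by decide⟩)
    (h10 : P ⟨(1, 0), by decide⟩) (h11 : P ⟨(1, 1), by decide⟩) (h12 : P ⟨(1, 2), by decide⟩)
    (h20 : P ⟨(2, 0), by decide⟩) (h21 : P ⟨(2, 1), by decide⟩) (h22 : P ⟨(2, 2), by decide⟩)
    (a : Idx) : P a := by
  obtain ⟨⟨i, j⟩, h⟩ := a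
  fin_cases i <;> fin_cases j
  · exact absurd rfl h
  all_goals assumption

theorem coord_split_mul {R : Type*} [CommRing R] (x y : SplitOkubo R) :
    coord ⟨(0, 1), by decide⟩ (x * y) = coord ⟨(0, 2), by decide⟩ x * coord ⟨(0, 2), by decide⟩ y
      - coord ⟨(1, 0), by decide⟩ x * coord ⟨(2, 1), by decide⟩ y
      - coord ⟨(1, 1), by decide⟩ x * coord ⟨(2, 0), by decide⟩ y
      - coord ⟨(1, 2), by decide⟩ x * coord ⟨(2, 2), by decide⟩ y ∧
    coord ⟨(0, 2), by decide⟩ (x * y) = coord ⟨(0, 1), by decide⟩ x * coord ⟨(0, 1), by decide⟩ y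
      - coord ⟨(2, 0), by decide⟩ x * coord ⟨(1, 2), by decide⟩ y
      - coord ⟨(2, 1), by decide⟩ x * coord ⟨(1, 1), by decide⟩ y
      - coord ⟨(2, 2), by decide⟩ x * coord ⟨(1, 0), by decide⟩ y ∧
    coord ⟨(1, 0), by decide⟩ (x * y) = -(coord ⟨(0, 2), by decide⟩ x * coord ⟨(1, 1), by decide⟩ y)
      - coord ⟨(1, 2), by decide⟩ x * coord ⟨(0, 1), by decide⟩ y
      + coord ⟨(2, 0), by decide⟩ x * coord ⟨(2, 0), by decide⟩ y
      - coord ⟨(2, 2), by decide⟩ x * coord ⟨(2, 1), by decide⟩ y ∧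
    coord ⟨(1, 1), by decide⟩ (x * y) = -(coord ⟨(0, 2), by decide⟩ x * coord ⟨(1, 2), by decide⟩ y)
      - coord ⟨(1, 0), by decide⟩ x * coord ⟨(0, 1), by decide⟩ y
      - coord ⟨(2, 1), by decide⟩ x * coord ⟨(2, 0), by decide⟩ y
      + coord ⟨(2, 2), by decide⟩ x * coord ⟨(2, 2), by decide⟩ y ∧
    coord ⟨(1, 2), by decide⟩ (x * y) = -(coord ⟨(0, 2), by decide⟩ x * coord ⟨(1, 0), by decide⟩ y)
      - coord ⟨(1, 1), by decide⟩ x * coord ⟨(0, 1), by decide⟩ y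
      - coord ⟨(2, 0), by decide⟩ x * coord ⟨(2, 2), by decide⟩ y
      + coord ⟨(2, 1), by decide⟩ x * coord ⟨(2, 1), by decide⟩ y ∧
    coord ⟨(2, 0), by decide⟩ (x * y) = -(coord ⟨(0, 1), by decide⟩ x * coord ⟨(2, 2), by decide⟩ y)
      + coord ⟨(1, 0), by decide⟩ x * coord ⟨(1, 0), by decide⟩ y
      - coord ⟨(1, 1), by decide⟩ x * coord ⟨(1, 2), by decide⟩ y
      - coord ⟨(2, 1), by decide⟩ x * coord ⟨(0, 2), by decide⟩ y ∧
    coord ⟨(2, 1), by decide⟩ (x * y) = -(coord ⟨(0, 1), by decide⟩ x * coord ⟨(2, 0), by decide⟩ y)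
      - coord ⟨(1, 0), by decide⟩ x * coord ⟨(1, 1), by decide⟩ y
      + coord ⟨(1, 2), by decide⟩ x * coord ⟨(1, 2), by decide⟩ y
      - coord ⟨(2, 2), by decide⟩ x * coord ⟨(0, 2), by decide⟩ y ∧
    coord ⟨(2, 2), by decide⟩ (x * y) = -(coord ⟨(0, 1), by decide⟩ x * coord ⟨(2, 1), by decide⟩ y)
      + coord ⟨(1, 1), by decide⟩ x * coord ⟨(1, 1), by decide⟩ y
      - coord ⟨(1, 2), by decide⟩ x * coord ⟨(1, 0), by decide⟩ y
      - coord ⟨(2, 0), by decide⟩ x * coord ⟨(0, 2), by decide⟩ y := by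
  refine ⟨?_, ?_, ?_, ?_, ?_, ?_, ?_, ?_⟩ <;>
  · simp only [coord_mul, sum_idx, one_pow, mul_one]
    simp +decide [sgn]
    try ring

theorem isSymmComp_split (E : Type*) [Field E] : IsSymmComp (norm E 1 1) where
  mul_mul_self x y := by
    refine ext (forall_idx ?_ ?_ ?_ ?_ ?_ ?_ ?_ ?_) <;>
    · simp only [coord_split_mul, map_smul, norm, add_apply, smul_apply,
        QuadraticMap.linMulLin_apply, smul_eq_mul]
      ring
  self_mul_mul x y := by
    refine ext (forall_idx ?_ ?_ ?_ ?_ ?_ ?_ ?_ ?_) <;>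
    · simp only [coord_split_mul, map_smul, norm, add_apply, smul_apply,
        QuadraticMap.linMulLin_apply, smul_eq_mul]
      ring
  nondeg x h := by
    -- The only basis vector not orthogonal to `z a` is `z (-a)`, with value `1` since `α = β = 1`.
    have key : ∀ a : Idx, QuadraticMap.polar (norm E 1 1) x (z ⟨-a.val, neg_ne_zero.2 a.2⟩)
        = coord a x := by
      refine forall_idx ?_ ?_ ?_ ?_ ?_ ?_ ?_ ?_ <;>
      · simp +decide [QuadraticMap.polar, norm, coord_z]
        try ring
    exact ext fun a => by rw [← key, h, map_zero]

end OkuboAlg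

open QuadraticMap (polar polar_add_left polar_add_right polar_smul_left polar_smul_right)

/-! ### Symmetric composition algebras and their special gradings. -/

section SymmComp

variable {E A : Type*} [Field E] [NonUnitalNonAssocRing A] [Module E A]
  {n : QuadraticForm E A}

namespace IsSymmComp

/-- Linearization of `mul_mul_self` in its repeated variable; `mul_mul_add'` does the same for
`self_mul_mul`. -/
theorem mul_mul_add (hn : IsSymmComp n) (x y z : A) :
    x * y * z + z * y * x = polar n x z • y := by
  have h := hn.mul_mul_self (x + z) y
  simp only [add_mul, mul_add, hn.mul_mul_self] at h
  rw [QuadraticMap.polar, sub_smul, sub_smul, ← h]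
  abel

theorem mul_mul_add' (hn : IsSymmComp n) (x y z : A) :
    x * (y * z) + z * (y * x) = polar n x z • y := by
  have h := hn.self_mul_mul (x + z) y
  simp only [add_mul, mul_add, hn.self_mul_mul] at h
  rw [QuadraticMap.polar, sub_smul, sub_smul, ← h]
  abel

theorem sq_mul_sq [IsScalarTower E A A] (hn : IsSymmComp n) {x : A} (hx : n x = 0) :
    x * x * (x * x) = polar n x (x * x) • x := by
  have h := hn.mul_mul_add x x (x * x)
  rwa [hn.mul_mul_self, hx, zero_smul, zero_mul, add_zero] at h

end IsSymmComp

namespace Grading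

variable {G : Type*} [AddCommGroup G] [DecidableEq G] {Γ : Grading E G A}

theorem eq_of_mem_comp {x : A} {g h : G} (hx : x ∈ Γ.comp g) (hx' : x ∈ Γ.comp h)
    (hx0 : x ≠ 0) : g = h := by
  by_contra hgh
  exact hx0 (Submodule.disjoint_def.1
    (Γ.isInternal.submodule_iSupIndep.pairwiseDisjoint hgh) x hx hx')

theorem induction_comp {P : A → Prop} (h0 : P 0) (hadd : ∀ x y, P x → P y → P (x + y))
    (h : ∀ g, ∀ x ∈ Γ.comp g, P x) (x : A) : P x :=
  Submodule.iSup_induction Γ.comp (motive := P)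
    (Γ.isInternal.submodule_iSup_eq_top ▸ Submodule.mem_top) h h0 hadd

theorem IsSpecial.mul_eq_zero (hΓ : Γ.IsSpecial) {x y : A} {g h : G} (hx : x ∈ Γ.comp g)
    (hy : y ∈ Γ.comp h) (hgh : g + h = 0) : x * y = 0 := by
  have := Γ.mul_mem hx hy
  rwa [hgh, hΓ, Submodule.mem_bot] at this

/-- By linearization, multiplication by the scalar `n(x, y)` shifts degrees by `g + h`. If the
scalar is nonzero and `g + h ≠ 0`, no nonzero homogeneous element can exist. -/
theorem polar_eq_zero (Γ : Grading E G A) (hn : IsSymmComp n) {x y : A} {g h : G}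
    (hx : x ∈ Γ.comp g) (hy : y ∈ Γ.comp h) (hgh : g + h ≠ 0) : polar n x y = 0 := by
  by_contra hne
  have key : ∀ w : A, w = 0 := by
    refine induction_comp (Γ := Γ) rfl (fun a b ha hb => by rw [ha, hb, add_zero])
      fun k w hw => ?_
    by_contra hw0
    have h1 : polar n x y • w ∈ Γ.comp (g + h + k) := by
      rw [← hn.mul_mul_add]
      refine add_mem ?_ ?_
      · rw [add_right_comm]; exact Γ.mul_mem (Γ.mul_mem hx hw) hy
      · rw [add_comm g h, add_right_comm]; exact Γ.mul_mem (Γ.mul_mem hy hw) hx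
    rw [Submodule.smul_mem_iff _ hne] at h1
    have := eq_of_mem_comp hw h1 hw0
    exact hgh (by simpa using this.symm)
  refine hne ?_
  rw [key x]
  simp

/-- The element `n(x) x = (x * x) * x` has degree `3 • g`, so `n(x) ≠ 0` would force `g + g = 0`;
but then `x * x` lies in the trivial neutral component. -/
theorem IsSpecial.norm_eq_zero (hΓ : Γ.IsSpecial) (hn : IsSymmComp n) {x : A} {g : G}
    (hx : x ∈ Γ.comp g) : n x = 0 := by
  by_cases hx0 : x = 0
  · rw [hx0, QuadraticMap.map_zero]
  have h := hn.mul_mul_self x x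
  by_contra hne
  by_cases hg : g + g = 0
  · rw [hΓ.mul_eq_zero hx hx hg, zero_mul] at h
    exact (smul_ne_zero hne hx0) h.symm
  · have h1 : n x • x ∈ Γ.comp (g + g + g) := by
      rw [← h]; exact Γ.mul_mem (Γ.mul_mem hx hx) hx
    rw [Submodule.smul_mem_iff _ hne] at h1
    have := eq_of_mem_comp hx h1 hx0
    exact hg (by simpa using this.symm)

theorem exists_polar_ne_zero (Γ : Grading E G A) (hn : IsSymmComp n) {x : A} {g : G}
    (hx : x ∈ Γ.comp g) (hx0 : x ≠ 0) : ∃ y ∈ Γ.comp (-g), polar n x y ≠ 0 := by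
  by_contra! hcon
  refine hx0 (hn.nondeg x (induction_comp (Γ := Γ) (by simp)
    (fun a b ha hb => by rw [polar_add_right, ha, hb, add_zero]) fun k y hy => ?_))
  by_cases hk : g + k = 0
  · exact hcon y (by rwa [neg_eq_of_add_eq_zero_right hk])
  · exact Γ.polar_eq_zero hn hx hy hk

/-- For `y` of degree `-g` pairing nontrivially with `x`, the product `y * x` vanishes, so
linearization leaves `(x * x) * y = n(x, y) x ≠ 0`. -/
theorem IsSpecial.mul_self_ne_zero (hΓ : Γ.IsSpecial) (hn : IsSymmComp n) {x : A} {g : G}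
    (hx : x ∈ Γ.comp g) (hx0 : x ≠ 0) : x * x ≠ 0 := by
  obtain ⟨y, hy, hxy⟩ := Γ.exists_polar_ne_zero hn hx hx0
  intro h
  have h1 := hn.mul_mul_add x x y
  rw [h, hΓ.mul_eq_zero hy hx (neg_add_cancel g), zero_mul, zero_mul, add_zero] at h1
  exact smul_ne_zero hxy hx0 h1.symm

variable [IsScalarTower E A A]

/-- Squaring twice gives `n(x, x * x) x`, and squares of nonzero homogeneous elements are nonzero.
-/
theorem IsSpecial.polar_mul_self_ne_zero (hΓ : Γ.IsSpecial) (hn : IsSymmComp n) {x : A} {g : G}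
    (hx : x ∈ Γ.comp g) (hx0 : x ≠ 0) : polar n x (x * x) ≠ 0 := by
  intro h
  refine hΓ.mul_self_ne_zero hn (Γ.mul_mem hx hx) (hΓ.mul_self_ne_zero hn hx hx0) ?_
  rw [hn.sq_mul_sq (hΓ.norm_eq_zero hn hx), h, zero_smul]

theorem IsSpecial.three_nsmul_eq_zero (hΓ : Γ.IsSpecial) (hn : IsSymmComp n) {x : A} {g : G}
    (hx : x ∈ Γ.comp g) (hx0 : x ≠ 0) : 3 • g = 0 := by
  by_contra h
  refine hΓ.polar_mul_self_ne_zero hn hx hx0 (Γ.polar_eq_zero hn hx (Γ.mul_mem hx hx) ?_)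
  rwa [show g + (g + g) = 3 • g by abel]

open Polynomial in
/-- Over an algebraically closed field the cubic form `n(x, x * x)` is anisotropic on each
component, which is therefore of dimension at most one. -/
theorem IsSpecial.exists_smul_eq_of_isAlgClosed [IsAlgClosed E] [SMulCommClass E A A]
    (hΓ : Γ.IsSpecial) (hn : IsSymmComp n)
    {x y : A} {g : G} (hx : x ∈ Γ.comp g) (hy : y ∈ Γ.comp g) (hx0 : x ≠ 0) :
    ∃ t : E, t • x = y := by
  have hc := hΓ.polar_mul_self_ne_zero hn hx hx0
  -- The value of `p` at `t` is `n(u, u * u)` for `u = t • x + y`. Its leading coefficient is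
  -- nonzero, so it has a root, and anisotropy makes the corresponding `u` zero.
  set p : E[X] := C (polar n x (x * x)) * X ^ 3
    + C (polar n x (x * y) + polar n x (y * x) + polar n y (x * x)) * X ^ 2
    + C (polar n x (y * y) + polar n y (x * y) + polar n y (y * x)) * X
    + C (polar n y (y * y)) with hp
  have hdeg : p.degree = 3 := degree_cubic hc
  obtain ⟨t, ht⟩ := IsAlgClosed.exists_root p (by rw [hdeg]; decide)
  have hu : t • x + y = 0 := by
    by_contra hne
    refine hΓ.polar_mul_self_ne_zero hn (add_mem (Submodule.smul_mem _ t hx) hy) hne ?_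
    rw [IsRoot.def] at ht
    rw [← ht, hp]
    simp only [mul_add, add_mul, smul_mul_assoc, mul_smul_comm, polar_add_left, polar_add_right,
      polar_smul_left, polar_smul_right, smul_eq_mul, eval_add, eval_mul, eval_C, eval_pow, eval_X]
    ring
  exact ⟨-t, by rw [neg_smul]; exact (eq_neg_of_add_eq_zero_right hu).symm⟩

end Grading

end SymmComp

/-! ### Descent from the algebraic closure. -/

theorem one_tmul_injective {F O : Type*} [Field F] [AddCommGroup O] [Module F O]
    (K : Type*) [Field K] [Algebra F K] :
    Function.Injective fun x : O => (1 : K) ⊗ₜ[F] x := by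
  intro x y h
  exact (Module.Flat.rTensor_preserves_injective_linearMap (M := O)
    (Algebra.linearMap F K) (algebraMap F K).injective).comp (TensorProduct.lid F O).symm.injective
    (by simpa using h)

section Descent

variable {F : Type*} [Field F] {O : Type*} [NonUnitalNonAssocRing O] [Module F O]
  [IsScalarTower F O O] [SMulCommClass F O O] {n : QuadraticForm F O}

theorem IsSymmComp.comp_equiv {E A B : Type*} [Field E] [NonUnitalNonAssocRing A] [Module E A]
    [NonUnitalNonAssocRing B] [Module E B] {m : QuadraticForm E B} (hm : IsSymmComp m)
    (φ : A ≃ₗ[E] B) (hφ : ∀ x y, φ (x * y) = φ x * φ y) :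
    IsSymmComp (m.comp (φ : A →ₗ[E] B)) where
  mul_mul_self x y := φ.injective (by simp [hφ, hm.mul_mul_self])
  self_mul_mul x y := φ.injective (by simp [hφ, hm.self_mul_mul])
  nondeg x h := φ.injective (by
    rw [map_zero]
    refine hm.nondeg _ fun y => ?_
    simpa [polar] using h (φ.symm y))

theorem IsOkuboAlgebra.exists_baseChange (hO : IsOkuboAlgebra F O n) :
    ∃ m : QuadraticForm (AlgebraicClosure F) (AlgebraicClosure F ⊗[F] O), IsSymmComp m ∧
      ∀ x, m (1 ⊗ₜ[F] x) = algebraMap F (AlgebraicClosure F) (n x) := by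
  obtain ⟨φ, hφ, hn⟩ := hO
  exact ⟨_, (OkuboAlg.isSymmComp_split _).comp_equiv φ hφ, hn⟩

/-- The identities restrict along the injection `x ↦ 1 ⊗ x`. A vector in the radical of `n` stays in
the radical of `m`, since the elements `1 ⊗ y` span over `K`. -/
theorem IsSymmComp.descend {K : Type*} [Field K] [Algebra F K]
    {m : QuadraticForm K (K ⊗[F] O)} (hm : IsSymmComp m)
    (hmn : ∀ x, m (1 ⊗ₜ[F] x) = algebraMap F K (n x)) : IsSymmComp n where
  mul_mul_self x y := one_tmul_injective (F := F) K (by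
    have := hm.mul_mul_self (1 ⊗ₜ[F] x) (1 ⊗ₜ[F] y)
    simpa [hmn, algebraMap_smul, -TensorProduct.tmul_smul, ← TensorProduct.tmul_smul] using this)
  self_mul_mul x y := one_tmul_injective (F := F) K (by
    have := hm.self_mul_mul (1 ⊗ₜ[F] x) (1 ⊗ₜ[F] y)
    simpa [hmn, algebraMap_smul, -TensorProduct.tmul_smul, ← TensorProduct.tmul_smul] using this)
  nondeg x h := one_tmul_injective (F := F) K (by
    simp only [TensorProduct.tmul_zero]
    refine hm.nondeg _ fun y => ?_
    induction y with
    | zero => simp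
    | add y z hy hz => rw [polar_add_right, hy, hz, add_zero]
    | tmul t y =>
      have : t ⊗ₜ[F] y = t • ((1 : K) ⊗ₜ[F] y) := by simp [TensorProduct.smul_tmul']
      rw [this, polar_smul_right, polar, ← TensorProduct.tmul_add, hmn, hmn, hmn, ← map_sub,
        ← map_sub]
      change t • algebraMap F K (polar n x y) = 0
      rw [h, map_zero, smul_zero])

/-- The extension of scalars of a grading. -/
noncomputable def Grading.baseChange (K : Type*) [Field K] [Algebra F K] {G : Type*}
    [AddCommGroup G] [DecidableEq G] (Γ : Grading F G O) : Grading K G (K ⊗[F] O) where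
  comp g := (Γ.comp g).baseChange K
  isInternal := Γ.isInternal.baseChange
  mul_mem := by
    intro g h x y hx hy
    rw [Submodule.baseChange_eq_span] at hx hy
    induction hx, hy using Submodule.span_induction₂ with
    | mem_mem x y hx hy =>
      obtain ⟨x, hx, rfl⟩ := hx
      obtain ⟨y, hy, rfl⟩ := hy
      simpa using Submodule.tmul_mem_baseChange_of_mem 1 (Γ.mul_mem hx hy)
    | zero_left y hy => simp
    | zero_right x hx => simp
    | add_left x y z _ _ _ h1 h2 => rw [add_mul]; exact add_mem h1 h2
    | add_right x y z _ _ _ h1 h2 => rw [mul_add]; exact add_mem h1 h2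
    | smul_left r x y _ _ h => rw [smul_mul_assoc]; exact Submodule.smul_mem _ _ h
    | smul_right r x y _ _ h => rw [mul_smul_comm]; exact Submodule.smul_mem _ _ h

variable {G : Type*} [AddCommGroup G] [DecidableEq G] {Γ : Grading F G O}

theorem IsOkuboAlgebra.isSymmComp (hO : IsOkuboAlgebra F O n) : IsSymmComp n := by
  obtain ⟨m, hm, hmn⟩ := hO.exists_baseChange
  exact hm.descend hmn

theorem IsOkuboAlgebra.finrank_eq (hO : IsOkuboAlgebra F O n) : Module.finrank F O = 8 := by
  obtain ⟨φ, -, -⟩ := hO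
  rw [← Module.finrank_baseChange (R := AlgebraicClosure F), φ.finrank_eq]
  change Module.finrank (AlgebraicClosure F) (Idx → AlgebraicClosure F) = 8
  rw [Module.finrank_fintype_fun_eq_card]
  decide

theorem IsOkuboAlgebra.exists_smul_eq (hO : IsOkuboAlgebra F O n) (hΓ : Γ.IsSpecial)
    {x y : O} {g : G} (hx : x ∈ Γ.comp g) (hy : y ∈ Γ.comp g) (hx0 : x ≠ 0) :
    ∃ t : F, t • x = y := by
  obtain ⟨m, hm, hmn⟩ := hO.exists_baseChange
  have hΓ' : (Γ.baseChange (AlgebraicClosure F)).IsSpecial := by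
    have : Γ.comp 0 = ⊥ := hΓ
    simp [Grading.IsSpecial, Grading.baseChange, this]
  obtain ⟨t, ht⟩ := hΓ'.exists_smul_eq_of_isAlgClosed hm
    (Submodule.tmul_mem_baseChange_of_mem 1 hx) (Submodule.tmul_mem_baseChange_of_mem 1 hy)
    (fun h => hx0 (one_tmul_injective (F := F) (AlgebraicClosure F) (by simpa using h)))
  -- The ratio `t` lives in the closure; a functional with `f x = 1` shows that it equals `f y`,
  -- hence is in `F`.
  obtain ⟨f, hf⟩ := Module.Projective.exists_dual_eq_one F hx0
  have h1 := congrArg (Module.Dual.baseChange (AlgebraicClosure F) f) ht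
  have h2 : t = algebraMap F (AlgebraicClosure F) (f y) := by
    simpa [hf, Algebra.smul_def] using h1
  refine ⟨f y, one_tmul_injective (F := F) (AlgebraicClosure F) ?_⟩
  simp only [TensorProduct.tmul_smul]
  rw [← ht, h2, algebraMap_smul]

end Descent

/-! ### The multiplication table generated by `e` and `f` with `f * e = 0`. -/

section Table

variable {F A : Type*} [Field F] [NonUnitalNonAssocRing A] [Module F A]
  {n : QuadraticForm F A}

namespace IsSymmComp

section Pairs

variable {x w : A}

theorem mul_mul_left (hn : IsSymmComp n) (h : polar n x w = 0) : x * (x * w) = -(w * (x * x)) := by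
  have := hn.mul_mul_add' x x w
  rw [h, zero_smul] at this
  exact eq_neg_of_add_eq_zero_left this

theorem mul_mul_right (hn : IsSymmComp n) (h : polar n x w = 0) :
    x * w * w = -(w * w * x) := by
  have := hn.mul_mul_add x w w
  rw [h, zero_smul] at this
  exact eq_neg_of_add_eq_zero_left this

theorem sq_mul (hn : IsSymmComp n) (h : polar n x w = 0) (hwx : w * x = 0) : x * x * w = 0 := by
  have := hn.mul_mul_add x x w
  rwa [h, zero_smul, hwx, zero_mul, add_zero] at this

theorem mul_sq (hn : IsSymmComp n) (h : polar n x w = 0) (hwx : w * x = 0) : x * (w * w) = 0 := by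
  have := hn.mul_mul_add' x w w
  rwa [h, zero_smul, hwx, mul_zero, add_zero] at this

/-- Linearization turns the square into `-((x * w) * w) * x`; `mul_mul_right` is then applied twice,
the second time to the pair `w * w`, `x`. -/
theorem mul_mul_mul_self (hn : IsSymmComp n) (h : polar n x w = 0)
    (h1 : polar n x (x * w) = 0) (h2 : polar n (w * w) x = 0) :
    x * w * (x * w) = -(x * x * (w * w)) := by
  have := hn.mul_mul_add x w (x * w)
  rw [h1, zero_smul, hn.mul_mul_right h, neg_mul, hn.mul_mul_right h2, neg_neg] at this
  exact eq_neg_of_add_eq_zero_left this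

theorem mul_mul_sq (hn : IsSymmComp n) (h : x * x * w = 0) :
    x * w * (x * x) = polar n x (x * x) • w := by
  have := hn.mul_mul_add x w (x * x)
  rwa [h, zero_mul, add_zero] at this

theorem sq_mul_mul (hn : IsSymmComp n) (h : x * (w * w) = 0) :
    w * w * (x * w) = polar n w (w * w) • x := by
  have := hn.mul_mul_add' (w * w) x w
  rwa [h, mul_zero, add_zero, QuadraticMap.polar_comm] at this

end Pairs

end IsSymmComp

/-- The elements `z̃_a` expressed through `e = z̃_{1,0}` and `f = z̃_{0,1}`, with `z̃_0 = 0`. -/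
def canonicalFamily (e f : A) (a : ZMod 3 × ZMod 3) : A :=
  (![![0, f, f * f], ![e, -(e * f), -(f * f * e)],
    ![e * e, -(f * (e * e)), -(e * e * (f * f))]] : Fin 3 → Fin 3 → A) a.1 a.2

theorem forall_zmod_three_prod {P : ZMod 3 × ZMod 3 → Prop}
    (h00 : P (0, 0)) (h01 : P (0, 1)) (h02 : P (0, 2))
    (h10 : P (1, 0)) (h11 : P (1, 1)) (h12 : P (1, 2))
    (h20 : P (2, 0)) (h21 : P (2, 1)) (h22 : P (2, 2)) (a : ZMod 3 × ZMod 3) : P a := by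
  obtain ⟨i, j⟩ := a
  fin_cases i <;> fin_cases j <;> assumption

variable {G : Type*} [AddCommGroup G] [DecidableEq G] {Γ : Grading F G A}

theorem canonicalFamily_mem {D : ZMod 3 × ZMod 3 →+ G} {e f : A} (he : e ∈ Γ.comp (D (1, 0)))
    (hf : f ∈ Γ.comp (D (0, 1))) : ∀ a, canonicalFamily e f a ∈ Γ.comp (D a) := by
  have mem : ∀ {a b c : ZMod 3 × ZMod 3} {x y : A}, x ∈ Γ.comp (D a) → y ∈ Γ.comp (D b) →
      a + b = c → x * y ∈ Γ.comp (D c) := by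
    rintro a b c x y hx hy rfl
    rw [map_add]
    exact Γ.mul_mem hx hy
  have hE : e * e ∈ Γ.comp (D (2, 0)) := mem he he (by decide)
  have hF : f * f ∈ Γ.comp (D (0, 2)) := mem hf hf (by decide)
  exact forall_zmod_three_prod (zero_mem _) hf hF he (neg_mem (mem he hf (by decide)))
    (neg_mem (mem hF he (by decide))) hE (neg_mem (mem hf hE (by decide)))
    (neg_mem (mem hE hF (by decide)))

variable [IsScalarTower F A A] [SMulCommClass F A A]

-- Every entry comes from a relation for a pair `(x, w)` of orthogonal homogeneous elements with `w
-- * x = 0`, or from two opposite degrees, whose product lies in the trivial component.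
set_option linter.unusedSimpArgs false in
set_option linter.flexible false in
theorem Grading.IsSpecial.canonicalFamily_mul (hΓ : Γ.IsSpecial) (hn : IsSymmComp n)
    {D : ZMod 3 × ZMod 3 →+ G} (hD : Function.Injective D) {e f : A}
    (he : e ∈ Γ.comp (D (1, 0))) (hf : f ∈ Γ.comp (D (0, 1))) (he0 : e ≠ 0) (hf0 : f ≠ 0)
    (hfe : f * e = 0) {α β : F} (hα : polar n e (e * e) = α) (hβ : polar n f (f * f) = β)
    (a b : Idx) :
    canonicalFamily e f a.val * canonicalFamily e f b.val
      = ((sgn a.val b.val : F) * α ^ carry a.val.1 b.val.1 * β ^ carry a.val.2 b.val.2)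
        • canonicalFamily e f (a.val + b.val) := by
  have hα0 : α ≠ 0 := hα ▸ hΓ.polar_mul_self_ne_zero hn he he0
  have hβ0 : β ≠ 0 := hβ ▸ hΓ.polar_mul_self_ne_zero hn hf hf0
  have orth : ∀ {a b : ZMod 3 × ZMod 3} {x y : A}, x ∈ Γ.comp (D a) → y ∈ Γ.comp (D b) →
      a + b ≠ 0 → polar n x y = 0 := fun hx hy hab => Γ.polar_eq_zero hn hx hy (by
    rwa [← map_add, Ne, map_eq_zero_iff D hD])
  have opp : ∀ {a b : ZMod 3 × ZMod 3} {x y : A}, x ∈ Γ.comp (D a) → y ∈ Γ.comp (D b) →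
      a + b = 0 → x * y = 0 := fun hx hy hab => hΓ.mul_eq_zero hx hy (by
    rw [← map_add, hab, map_zero])
  have iso : ∀ {a : ZMod 3 × ZMod 3} {x : A}, x ∈ Γ.comp (D a) → n x = 0 :=
    fun hx => hΓ.norm_eq_zero hn hx
  have hmem := canonicalFamily_mem he hf
  have hE := hmem (2, 0)
  have hF := hmem (0, 2)
  have hp := hmem (1, 1)
  have hr := hmem (1, 2)
  have hR := hmem (2, 1)
  have hP := hmem (2, 2)
  have z00 : canonicalFamily e f (0, 0) = 0 := rfl
  have z10 : canonicalFamily e f (1, 0) = e := rfl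
  have z01 : canonicalFamily e f (0, 1) = f := rfl
  -- The remaining monomials are made opaque, so that the relations below rewrite products of atoms.
  obtain ⟨E, z20⟩ : ∃ E, canonicalFamily e f (2, 0) = E := ⟨_, rfl⟩
  obtain ⟨F', z02⟩ : ∃ F', canonicalFamily e f (0, 2) = F' := ⟨_, rfl⟩
  obtain ⟨p, z11⟩ : ∃ p, canonicalFamily e f (1, 1) = p := ⟨_, rfl⟩
  obtain ⟨r, z12⟩ : ∃ r, canonicalFamily e f (1, 2) = r := ⟨_, rfl⟩
  obtain ⟨R, z21⟩ : ∃ R, canonicalFamily e f (2, 1) = R := ⟨_, rfl⟩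
  obtain ⟨P, z22⟩ : ∃ P, canonicalFamily e f (2, 2) = P := ⟨_, rfl⟩
  rw [z20] at hE
  rw [z02] at hF
  rw [z11] at hp
  rw [z12] at hr
  rw [z21] at hR
  rw [z22] at hP
  have ee : e * e = E := z20
  have ff : f * f = F' := z02
  have ef : e * f = -p := by rw [← z11]; exact (neg_neg _).symm
  have fE : f * E = -R := by rw [← z21, ← z20]; exact (neg_neg _).symm
  have Fe : F' * e = -r := by rw [← z12, ← z02]; exact (neg_neg _).symm
  have EF : E * F' = -P := by rw [← z22, ← z02, ← z20]; exact (neg_neg _).symm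
  have EE : E * E = α • e := by rw [← ee, hn.sq_mul_sq (iso he), hα]
  have FF : F' * F' = β • f := by rw [← ff, hn.sq_mul_sq (iso hf), hβ]
  rw [ee] at hα
  rw [ff] at hβ
  have hE' : polar n E (α • e) = α ^ 2 := by
    rw [polar_smul_right, QuadraticMap.polar_comm, hα, smul_eq_mul, sq]
  have hF' : polar n F' (β • f) = β ^ 2 := by
    rw [polar_smul_right, QuadraticMap.polar_comm, hβ, smul_eq_mul, sq]
  have fe := hfe
  -- The relation `f * e = 0` propagates around a cycle: the pairs `(e, f)`, `(f, E)`, `(E, F')`,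
  -- `(F', e)` all satisfy `w * x = 0`, and each yields the same set of relations.
  have Ef : E * f = 0 := ee ▸ hn.sq_mul (orth he hf (by decide)) fe
  have eF : e * F' = 0 := ff ▸ hn.mul_sq (orth he hf (by decide)) fe
  have FE : F' * E = 0 := ff ▸ hn.sq_mul (orth hf hE (by decide)) Ef
  have pe : p * e = 0 := by
    have := hn.mul_mul_self e f
    rwa [ef, iso he, zero_smul, neg_mul, neg_eq_zero] at this
  have fp : f * p = 0 := by
    have := hn.self_mul_mul f e
    rwa [ef, iso hf, zero_smul, mul_neg, neg_eq_zero] at this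
  have Rf : R * f = 0 := by
    have := hn.mul_mul_self f E
    rwa [fE, iso hf, zero_smul, neg_mul, neg_eq_zero] at this
  have ER : E * R = 0 := by
    have := hn.self_mul_mul E f
    rwa [fE, iso hE, zero_smul, mul_neg, neg_eq_zero] at this
  have rF : r * F' = 0 := by
    have := hn.mul_mul_self F' e
    rwa [Fe, iso hF, zero_smul, neg_mul, neg_eq_zero] at this
  have er : e * r = 0 := by
    have := hn.self_mul_mul e F'
    rwa [Fe, iso he, zero_smul, mul_neg, neg_eq_zero] at this
  have PE : P * E = 0 := by
    have := hn.mul_mul_self E F'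
    rwa [EF, iso hE, zero_smul, neg_mul, neg_eq_zero] at this
  have FP : F' * P = 0 := by
    have := hn.self_mul_mul F' E
    rwa [EF, iso hF, zero_smul, mul_neg, neg_eq_zero] at this
  have ep : e * p = -R := by
    have := hn.mul_mul_left (orth he hf (by decide))
    simp only [ef, ee, fE, mul_neg, neg_mul, neg_neg,
      smul_mul_assoc, mul_smul_comm, smul_neg, smul_smul] at this
    linear_combination (norm := module) (-1 : F) • this
  have pf : p * f = -r := by
    have := hn.mul_mul_right (orth he hf (by decide))
    simp only [ef, ff, Fe, mul_neg, neg_mul, neg_neg,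
      smul_mul_assoc, mul_smul_comm, smul_neg, smul_smul] at this
    linear_combination (norm := module) (-1 : F) • this
  have pp : p * p = P := by
    have := hn.mul_mul_mul_self (orth he hf (by decide))
      (orth he (by rw [ef]; exact neg_mem hp) (by decide : (1, 0) + (1, 1) ≠ (0 : ZMod 3 × ZMod 3)))
      (by rw [ff]; exact orth hF he (by decide))
    simp only [ef, ee, ff, EF, mul_neg, neg_mul, neg_neg,
      smul_mul_assoc, mul_smul_comm, smul_neg, smul_smul] at this
    linear_combination (norm := module) (1 : F) • this
  have pE : p * E = -(α • f) := by
    have := hn.mul_mul_sq (ee.symm ▸ Ef)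
    simp only [ef, ee, hα, mul_neg, neg_mul, neg_neg,
      smul_mul_assoc, mul_smul_comm, smul_neg, smul_smul] at this
    linear_combination (norm := module) (-1 : F) • this
  have Fp : F' * p = -(β • e) := by
    have := hn.sq_mul_mul (ff.symm ▸ eF)
    simp only [ef, ff, hβ, mul_neg, neg_mul, neg_neg,
      smul_mul_assoc, mul_smul_comm, smul_neg, smul_smul] at this
    linear_combination (norm := module) (-1 : F) • this
  have fR : f * R = -P := by
    have := hn.mul_mul_left (orth hf hE (by decide))
    simp only [fE, ff, EF, mul_neg, neg_mul, neg_neg,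
      smul_mul_assoc, mul_smul_comm, smul_neg, smul_smul] at this
    linear_combination (norm := module) (-1 : F) • this
  have RE : R * E = -(α • p) := by
    have := hn.mul_mul_right (orth hf hE (by decide))
    simp only [fE, EE, ef, mul_neg, neg_mul, neg_neg,
      smul_mul_assoc, mul_smul_comm, smul_neg, smul_smul] at this
    linear_combination (norm := module) (-1 : F) • this
  have RR : R * R = α • r := by
    have := hn.mul_mul_mul_self (orth hf hE (by decide))
      (orth hf (by rw [fE]; exact neg_mem hR) (by decide : (0, 1) + (2, 1) ≠ (0 : ZMod 3 × ZMod 3)))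
      (by rw [EE]; exact by rw [polar_smul_left, orth he hf (by decide), smul_zero])
    simp only [fE, ff, EE, Fe, mul_neg, neg_mul, neg_neg,
      smul_mul_assoc, mul_smul_comm, smul_neg, smul_smul] at this
    linear_combination (norm := module) (1 : F) • this
  have RF : R * F' = -(β • E) := by
    have := hn.mul_mul_sq (ff.symm ▸ FE)
    simp only [fE, ff, hβ, mul_neg, neg_mul, neg_neg,
      smul_mul_assoc, mul_smul_comm, smul_neg, smul_smul] at this
    linear_combination (norm := module) (-1 : F) • this
  have eR : e * R = -(α • f) := by
    have := hn.sq_mul_mul (x := f) (w := E) (by rw [EE, mul_smul_comm, fe, smul_zero])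
    simp only [hE', fE, EE, mul_neg, neg_mul, neg_neg,
      smul_mul_assoc, mul_smul_comm, smul_neg, smul_smul] at this
    -- Since `E * E = α • e`, the relation carries an extra factor `α`, which is cancelled.
    refine smul_right_injective A hα0 ?_
    simp only
    linear_combination (norm := module) (-1 : F) • this
  have Fr : F' * r = -(β • p) := by
    have := hn.mul_mul_left (orth hF he (by decide))
    simp only [Fe, FF, ef, mul_neg, neg_mul, neg_neg,
      smul_mul_assoc, mul_smul_comm, smul_neg, smul_smul] at this
    linear_combination (norm := module) (-1 : F) • this
  have re : r * e = -P := by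
    have := hn.mul_mul_right (orth hF he (by decide))
    simp only [Fe, ee, EF, mul_neg, neg_mul, neg_neg,
      smul_mul_assoc, mul_smul_comm, smul_neg, smul_smul] at this
    linear_combination (norm := module) (-1 : F) • this
  have rr : r * r = β • R := by
    have := hn.mul_mul_mul_self (orth hF he (by decide))
      (orth hF (by rw [Fe]; exact neg_mem hr) (by decide : (0, 2) + (1, 2) ≠ (0 : ZMod 3 × ZMod 3)))
      (by rw [ee]; exact orth hE hF (by decide))
    simp only [Fe, FF, ee, fE, mul_neg, neg_mul, neg_neg,
      smul_mul_assoc, mul_smul_comm, smul_neg, smul_smul] at this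
    linear_combination (norm := module) (1 : F) • this
  have rf : r * f = -(β • e) := by
    have := hn.mul_mul_sq (x := F') (w := e) (by rw [FF, smul_mul_assoc, fe, smul_zero])
    simp only [hF', Fe, FF, mul_neg, neg_mul, neg_neg,
      smul_mul_assoc, mul_smul_comm, smul_neg, smul_smul] at this
    refine smul_right_injective A hβ0 ?_
    simp only
    linear_combination (norm := module) (-1 : F) • this
  have Er : E * r = -(α • F') := by
    have := hn.sq_mul_mul (ee.symm ▸ FE)
    simp only [Fe, ee, hα, mul_neg, neg_mul, neg_neg,
      smul_mul_assoc, mul_smul_comm, smul_neg, smul_smul] at this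
    linear_combination (norm := module) (-1 : F) • this
  have EP : E * P = -(α • r) := by
    have := hn.mul_mul_left (orth hE hF (by decide))
    simp only [EF, EE, Fe, mul_neg, neg_mul, neg_neg,
      smul_mul_assoc, mul_smul_comm, smul_neg, smul_smul] at this
    linear_combination (norm := module) (-1 : F) • this
  have PF : P * F' = -(β • R) := by
    have := hn.mul_mul_right (orth hE hF (by decide))
    simp only [EF, FF, fE, mul_neg, neg_mul, neg_neg,
      smul_mul_assoc, mul_smul_comm, smul_neg, smul_smul] at this
    linear_combination (norm := module) (-1 : F) • this
  have PP : P * P = (α * β) • p := by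
    have := hn.mul_mul_mul_self (orth hE hF (by decide))
      (orth hE (by rw [EF]; exact neg_mem hP) (by decide : (2, 0) + (2, 2) ≠ (0 : ZMod 3 × ZMod 3)))
      (by rw [FF]; exact by rw [polar_smul_left, orth hf hE (by decide), smul_zero])
    simp only [EF, EE, FF, ef, mul_neg, neg_mul, neg_neg,
      smul_mul_assoc, mul_smul_comm, smul_neg, smul_smul] at this
    linear_combination (norm := module) (1 : F) • this
  have Pe : P * e = -(α • F') := by
    have := hn.mul_mul_sq (x := E) (w := F') (by rw [EE, smul_mul_assoc, eF, smul_zero])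
    simp only [hE', EF, EE, mul_neg, neg_mul, neg_neg,
      smul_mul_assoc, mul_smul_comm, smul_neg, smul_smul] at this
    refine smul_right_injective A hα0 ?_
    simp only
    linear_combination (norm := module) (-1 : F) • this
  have fP : f * P = -(β • E) := by
    have := hn.sq_mul_mul (x := E) (w := F') (by rw [FF, mul_smul_comm, Ef, smul_zero])
    simp only [hF', EF, FF, mul_neg, neg_mul, neg_neg,
      smul_mul_assoc, mul_smul_comm, smul_neg, smul_smul] at this
    refine smul_right_injective A hβ0 ?_
    simp only
    linear_combination (norm := module) (-1 : F) • this
  have hp0 : p ≠ 0 := by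
    rintro rfl
    rw [zero_mul, zero_eq_neg] at pE
    exact smul_ne_zero hα0 hf0 pE
  have hp' : polar n p P = α * β := by
    have := hn.sq_mul_sq (iso hp)
    rw [pp, PP] at this
    exact (smul_left_injective F hp0 this).symm
  -- The pairs `(e, p)` and `(p, f)` also satisfy `w * x = 0`; they supply products that the first
  -- cycle misses.
  have Ep : E * p = 0 := ee ▸ hn.sq_mul (orth he hp (by decide)) pe
  have eP : e * P = 0 := pp ▸ hn.mul_sq (orth he hp (by decide)) pe
  have Re : R * e = 0 := by
    have := hn.mul_mul_self e p
    rwa [ep, iso he, zero_smul, neg_mul, neg_eq_zero] at this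
  have pR : p * R = 0 := by
    have := hn.self_mul_mul p e
    rwa [ep, iso hp, zero_smul, mul_neg, neg_eq_zero] at this
  have PR : P * R = -((α * β) • e) := by
    have := hn.sq_mul_mul (pp.symm ▸ eP)
    simp only [ep, pp, hp', mul_neg, neg_mul, neg_neg,
      smul_mul_assoc, mul_smul_comm, smul_neg, smul_smul] at this
    linear_combination (norm := module) (-1 : F) • this
  have Rp : R * p = -(α • F') := by
    have := hn.mul_mul_right (orth he hp (by decide))
    simp only [ep, pp, Pe, mul_neg, neg_mul, neg_neg,
      smul_mul_assoc, mul_smul_comm, smul_neg, smul_smul] at this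
    linear_combination (norm := module) (-1 : F) • this
  have Pf : P * f = 0 := pp ▸ hn.sq_mul (orth hp hf (by decide)) fp
  have pF : p * F' = 0 := ff ▸ hn.mul_sq (orth hp hf (by decide)) fp
  have rp : r * p = 0 := by
    have := hn.mul_mul_self p f
    rwa [pf, iso hp, zero_smul, neg_mul, neg_eq_zero] at this
  have fr : f * r = 0 := by
    have := hn.self_mul_mul f p
    rwa [pf, iso hf, zero_smul, mul_neg, neg_eq_zero] at this
  have pr : p * r = -(β • E) := by
    have := hn.mul_mul_left (orth hp hf (by decide))
    simp only [pf, pp, fP, mul_neg, neg_mul, neg_neg,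
      smul_mul_assoc, mul_smul_comm, smul_neg, smul_smul] at this
    linear_combination (norm := module) (-1 : F) • this
  have rP : r * P = -((α * β) • f) := by
    have := hn.mul_mul_sq (pp.symm ▸ Pf)
    simp only [pf, pp, hp', mul_neg, neg_mul, neg_neg,
      smul_mul_assoc, mul_smul_comm, smul_neg, smul_smul] at this
    linear_combination (norm := module) (-1 : F) • this
  have rE : r * E = 0 := ee ▸ hn.mul_sq (orth hr he (by decide)) er
  have FR : F' * R = 0 := ff ▸ hn.sq_mul (orth hf hR (by decide)) Rf
  have Pr : P * r = 0 := pp ▸ hn.sq_mul (orth hp hr (by decide)) rp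
  have RP : R * P = 0 := pp ▸ hn.mul_sq (orth hR hp (by decide)) pR
  have eE : e * E = 0 := opp he hE (by decide)
  have Ee : E * e = 0 := opp hE he (by decide)
  have fF : f * F' = 0 := opp hf hF (by decide)
  have Ff : F' * f = 0 := opp hF hf (by decide)
  have pP : p * P = 0 := opp hp hP (by decide)
  have Pp : P * p = 0 := opp hP hp (by decide)
  have rR : r * R = 0 := opp hr hR (by decide)
  have Rr : R * r = 0 := opp hR hr (by decide)
  have h11 : (1 : ZMod 3) + 1 = 2 := rfl
  have h12 : (1 : ZMod 3) + 2 = 0 := rfl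
  have h21 : (2 : ZMod 3) + 1 = 0 := rfl
  have h22 : (2 : ZMod 3) + 2 = 1 := rfl
  have v0 : (0 : ZMod 3).val = 0 := rfl
  have v1 : (1 : ZMod 3).val = 1 := rfl
  have v2 : (2 : ZMod 3).val = 2 := rfl
  revert a b
  refine OkuboAlg.forall_idx ?_ ?_ ?_ ?_ ?_ ?_ ?_ ?_ <;>
  refine OkuboAlg.forall_idx ?_ ?_ ?_ ?_ ?_ ?_ ?_ ?_ <;>
  · simp only [Prod.mk_add_mk, h11, h12, h21, h22, add_zero, zero_add, z00, z10, z01, z20, z02, z11,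
      z12, z21, z22, mul_zero, zero_mul, smul_zero]
    try simp +decide only [carry, v0, v1, v2, sgn]
    try simp [*]

end Table

/-! ### The embedding of `(ℤ/3)²` into the grading group. -/

/-- The homomorphism `(i, j) ↦ i g + j h`, for elements `g`, `h` of order dividing three. -/
def degreeHom {G : Type*} [AddCommGroup G] {g h : G} (hg : 3 • g = 0) (hh : 3 • h = 0) :
    ZMod 3 × ZMod 3 →+ G :=
  (ZMod.lift 3 ⟨zmultiplesHom G g, by simpa [ofNat_zsmul] using hg⟩).coprod
    (ZMod.lift 3 ⟨zmultiplesHom G h, by simpa [ofNat_zsmul] using hh⟩)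

section degreeHom

variable {G : Type*} [AddCommGroup G] {g h : G} (hg : 3 • g = 0) (hh : 3 • h = 0)

theorem degreeHom_one_zero : degreeHom hg hh (1, 0) = g := by
  have : ZMod.lift 3 ⟨zmultiplesHom G g, by simpa [ofNat_zsmul] using hg⟩ ((1 : ℤ) : ZMod 3) = g :=
    by
    rw [ZMod.lift_coe]; simp
  simpa [degreeHom] using this

theorem degreeHom_zero_one : degreeHom hg hh (0, 1) = h := by
  have : ZMod.lift 3 ⟨zmultiplesHom G h, by simpa [ofNat_zsmul] using hh⟩ ((1 : ℤ) : ZMod 3) = h :=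
    by
    rw [ZMod.lift_coe]; simp
  simpa [degreeHom] using this

theorem degreeHom_injective (hg0 : g ≠ 0) (hh0 : h ≠ 0) (hgh : h ≠ g) (hgh' : h ≠ -g) :
    Function.Injective (degreeHom hg hh) := by
  rw [injective_iff_map_eq_zero]
  have d10 := degreeHom_one_zero hg hh
  have d01 := degreeHom_zero_one hg hh
  have hg2 : g + g = -g := eq_neg_of_add_eq_zero_left (by rw [← hg]; abel)
  have hh2 : h + h = -h := eq_neg_of_add_eq_zero_left (by rw [← hh]; abel)
  have d20 : degreeHom hg hh (2, 0) = -g := by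
    rw [← hg2]; nth_rw 2 [← d10]; nth_rw 3 [← d10]; rw [← map_add]; rfl
  have d02 : degreeHom hg hh (0, 2) = -h := by
    rw [← hh2]; nth_rw 2 [← d01]; nth_rw 3 [← d01]; rw [← map_add]; rfl
  have d : ∀ i j, degreeHom hg hh (i, j) = degreeHom hg hh (i, 0) + degreeHom hg hh (0, j) :=
    fun i j => by rw [← map_add]; simp
  refine forall_zmod_three_prod (fun _ => rfl) ?_ ?_ ?_ ?_ ?_ ?_ ?_ ?_
  · exact fun h0 => absurd (d01 ▸ h0) hh0
  · exact fun h0 => absurd (neg_eq_zero.1 (d02 ▸ h0)) hh0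
  · exact fun h0 => absurd (d10 ▸ h0) hg0
  · rw [d, d10, d01]; exact fun h0 => absurd (eq_neg_of_add_eq_zero_right h0) hgh'
  · rw [d, d10, d02]; exact fun h0 => absurd (add_neg_eq_zero.1 h0).symm hgh
  · exact fun h0 => absurd (neg_eq_zero.1 (d20 ▸ h0)) hg0
  · rw [d, d20, d01]; exact fun h0 => absurd (neg_add_eq_zero.1 h0).symm hgh
  · rw [d, d20, d02]; exact fun h0 => absurd (by
      have := eq_neg_of_add_eq_zero_right h0
      rwa [neg_neg, neg_eq_iff_eq_neg] at this) hgh'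

end degreeHom

/-! ### Choice of the generators and the equivalence. -/

variable {F : Type*} [Field F] {O : Type*} [NonUnitalNonAssocRing O] [Module F O]
  [IsScalarTower F O O] [SMulCommClass F O O] {n : QuadraticForm F O}
  {G : Type*} [AddCommGroup G] [DecidableEq G] {Γ : Grading F G O}

/-- Homogeneous elements of independent degrees multiply to zero in some order. -/
theorem IsOkuboAlgebra.mul_eq_zero_or (hO : IsOkuboAlgebra F O n) (hΓ : Γ.IsSpecial)
    {x w : O} {g h : G} (hx : x ∈ Γ.comp g) (hw : w ∈ Γ.comp h) (hx0 : x ≠ 0)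
    (hgh : h ≠ g) (hgh' : h ≠ -g) : x * w = 0 ∨ w * x = 0 := by
  have hn := hO.isSymmComp
  by_contra! hne
  obtain ⟨hxw, hwx⟩ := hne
  have hg3 : 3 • g = 0 := hΓ.three_nsmul_eq_zero hn hx hx0
  have hxx := Γ.mul_mem hx hx
  have hn1 : polar n x w = 0 := Γ.polar_eq_zero hn hx hw fun h0 =>
    hgh' (eq_neg_of_add_eq_zero_right h0)
  -- Both products are nonzero in one component of dimension one, hence proportional. Then `x * (x *
  -- w)` and `(x * x) * w` vanish, so `(x * w) * (x * x)` equals `n(x, x * x) w ≠ 0`; but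
  -- linearizing with the pair `x`, `x * w` makes it zero.
  obtain ⟨t, ht⟩ := hO.exists_smul_eq hΓ (Γ.mul_mem hx hw)
    (by rw [add_comm]; exact Γ.mul_mem hw hx) hxw
  have nx := hΓ.norm_eq_zero hn hx
  have hw0 : w ≠ 0 := by rintro rfl; simp at hxw
  have h1 : w * x * x = 0 := by
    rw [← ht, smul_mul_assoc, hn.mul_mul_self, nx, zero_smul, smul_zero]
  have ht0 : t ≠ 0 := by rintro rfl; rw [zero_smul] at ht; exact hwx ht.symm
  have h2 : x * (x * w) = 0 := by
    have := hn.self_mul_mul x w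
    rw [← ht, mul_smul_comm, nx, zero_smul] at this
    exact (smul_eq_zero.1 this).resolve_left ht0
  have h3 : x * x * w = 0 := by
    have := hn.mul_mul_add x x w
    rwa [h1, add_zero, hn1, zero_smul] at this
  have h4 := hn.mul_mul_sq h3
  have h5 : polar n x (x * w) = 0 := Γ.polar_eq_zero hn hx (Γ.mul_mem hx hw) fun h0 =>
    hgh (by
      have h6 : g + (g + h) = 3 • g + (h - g) := by abel
      rw [h6, hg3, zero_add] at h0
      exact sub_eq_zero.1 h0)
  have h6 := hn.mul_mul_left h5
  rw [h2, mul_zero, zero_eq_neg] at h6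
  rw [h6] at h4
  exact smul_ne_zero (hΓ.polar_mul_self_ne_zero hn hx hx0) hw0 h4.symm

/-- There are two homogeneous elements of independent degrees. -/
theorem IsOkuboAlgebra.exists_independent (hO : IsOkuboAlgebra F O n) (hΓ : Γ.IsSpecial) :
    ∃ g h : G, ∃ x ∈ Γ.comp g, ∃ w ∈ Γ.comp h, x ≠ 0 ∧ w ≠ 0 ∧ h ≠ g ∧ h ≠ -g := by
  have hn := hO.isSymmComp
  have hfin := hO.finrank_eq
  have : Nontrivial O := Module.nontrivial_of_finrank_pos (R := F) (by omega)
  obtain ⟨g, x, hx, hx0⟩ : ∃ g, ∃ x ∈ Γ.comp g, x ≠ 0 := by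
    by_contra! hcon
    obtain ⟨y, hy⟩ := exists_ne (0 : O)
    exact hy (Grading.induction_comp (Γ := Γ) (P := (· = 0)) rfl
      (fun a b ha hb => by rw [ha, hb, add_zero])
      hcon y)
  refine ⟨g, ?_⟩
  by_contra! hcon
  have hxx := Γ.mul_mem hx hx
  have hg3 : 3 • g = 0 := hΓ.three_nsmul_eq_zero hn hx hx0
  have hg2 : g + g = -g := eq_neg_of_add_eq_zero_left (by rw [← hg3]; abel)
  -- If every degree of the support is `g` or `-g = g + g`, the elements `x` and `x * x` span
  -- everything, against dimension 8.
  have key : ∀ y : O, y ∈ Submodule.span F ({x, x * x} : Set O) := by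
    refine Grading.induction_comp (Γ := Γ) (zero_mem _) (fun a b ha hb => add_mem ha hb)
      fun k y hy => ?_
    by_cases hy0 : y = 0
    · rw [hy0]; exact zero_mem _
    by_cases hk : k = g
    · subst hk
      obtain ⟨t, rfl⟩ := hO.exists_smul_eq hΓ hx hy hx0
      exact Submodule.smul_mem _ _ (Submodule.subset_span (by simp))
    · have hk' := hcon k x hx y hy hx0 hy0 hk
      rw [hk', ← hg2] at hy
      obtain ⟨t, rfl⟩ := hO.exists_smul_eq hΓ hxx hy (hΓ.mul_self_ne_zero hn hx hx0)
      exact Submodule.smul_mem _ _ (Submodule.subset_span (by simp))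
  have h1 : Submodule.span F ({x, x * x} : Set O) = ⊤ := eq_top_iff.2 fun y _ => key y
  have h2 : Module.finrank F (Submodule.span F ({x, x * x} : Set O)) ≤ 2 := by
    classical
    have := finrank_span_finset_le_card (R := F) ({x, x * x} : Finset O)
    simp only [Finset.coe_insert, Finset.coe_singleton] at this
    exact this.trans Finset.card_le_two
  rw [h1, finrank_top, hfin] at h2
  omega

/-- Each mixed monomial has a product with another member of the family that is a nonzero multiple
of an element already known to be nonzero. -/
theorem Grading.IsSpecial.canonicalFamily_ne_zero (hΓ : Γ.IsSpecial) (hn : IsSymmComp n)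
    {D : ZMod 3 × ZMod 3 →+ G} (hD : Function.Injective D) {e f : O}
    (he : e ∈ Γ.comp (D (1, 0))) (hf : f ∈ Γ.comp (D (0, 1))) (he0 : e ≠ 0) (hf0 : f ≠ 0)
    (hfe : f * e = 0) (a : Idx) : canonicalFamily e f a.val ≠ 0 := by
  have hα0 := hΓ.polar_mul_self_ne_zero hn he he0
  have hβ0 := hΓ.polar_mul_self_ne_zero hn hf hf0
  have table := hΓ.canonicalFamily_mul hn hD he hf he0 hf0 hfe rfl rfl
  have key : ∀ a b c : Idx, a.val + b.val = c.val → sgn a.val b.val = -1 →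
      canonicalFamily e f c.val ≠ 0 → canonicalFamily e f a.val ≠ 0 := by
    intro a b c hab hs hc h0
    have := table a b
    rw [h0, zero_mul, hab, hs] at this
    refine smul_ne_zero ?_ hc this.symm
    simp [hα0, hβ0]
  have h10 : canonicalFamily e f (1, 0) ≠ 0 := he0
  have h01 : canonicalFamily e f (0, 1) ≠ 0 := hf0
  revert a
  refine OkuboAlg.forall_idx h01 (hΓ.mul_self_ne_zero hn hf hf0) h10 ?_ ?_
    (hΓ.mul_self_ne_zero hn he he0) ?_ ?_
  · exact key ⟨(1, 1), by decide⟩ ⟨(2, 0), by decide⟩ ⟨(0, 1), by decide⟩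
      (by decide) (by decide) h01
  · exact key ⟨(1, 2), by decide⟩ ⟨(0, 1), by decide⟩ ⟨(1, 0), by decide⟩
      (by decide) (by decide) h10
  · exact key ⟨(2, 1), by decide⟩ ⟨(1, 1), by decide⟩ ⟨(0, 2), by decide⟩ (by decide) (by decide)
      (hΓ.mul_self_ne_zero hn hf hf0)
  · exact key ⟨(2, 2), by decide⟩ ⟨(2, 1), by decide⟩ ⟨(1, 0), by decide⟩
      (by decide) (by decide) h10

theorem OkuboAlg.z_mul_z {R : Type*} [CommRing R] {α β : R} (a b c : Idx) :
    coord c (z a * z b : OkuboAlg R α β) = if a.val + b.val = c.val then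
      (sgn a.val b.val : R) * α ^ carry a.val.1 b.val.1 * β ^ carry a.val.2 b.val.2 else 0 := by
  rw [coord_mul, Finset.sum_eq_single a, Finset.sum_eq_single b]
  · simp [coord_z]
  · intro b' _ hb
    simp [coord_z, hb]
  · simp
  · intro a' _ ha
    simp [coord_z, ha]
  · simp

theorem IsOkuboAlgebra.equivalent_canonicalGrading (hO : IsOkuboAlgebra F O n) (hΓ : Γ.IsSpecial)
    {D : ZMod 3 × ZMod 3 →+ G} (hD : Function.Injective D) {e f : O}
    (he : e ∈ Γ.comp (D (1, 0))) (hf : f ∈ Γ.comp (D (0, 1))) (he0 : e ≠ 0) (hf0 : f ≠ 0)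
    (hfe : f * e = 0) {α β : F} (hα : polar n e (e * e) = α) (hβ : polar n f (f * f) = β) :
    Γ.Equivalent (canonicalGrading α β) := by
  have hn := hO.isSymmComp
  have table := hΓ.canonicalFamily_mul hn hD he hf he0 hf0 hfe hα hβ
  have hmem := canonicalFamily_mem he hf
  have hne := hΓ.canonicalFamily_ne_zero hn hD he hf he0 hf0 hfe
  have hDi : Function.Injective fun a : Idx => D a.val := hD.comp Subtype.val_injective
  have hli : LinearIndependent F fun a : Idx => canonicalFamily e f a.val :=
    (Γ.isInternal.submodule_iSupIndep.comp hDi).linearIndependent _ (fun a => hmem a.val) hne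
  have : Nonempty Idx := ⟨⟨(0, 1), by decide⟩⟩
  let b := basisOfLinearIndependentOfCardEqFinrank hli (by rw [hO.finrank_eq]; decide)
  have hb : ∀ a, b a = canonicalFamily e f a.val := fun a => by
    simp [b]
  let φ : O ≃ₗ[F] OkuboAlg F α β := b.equivFun
  have hφc : ∀ x c, OkuboAlg.coord c (φ x) = b.repr x c := fun x c => rfl
  have hφ : ∀ a, φ (b a) = OkuboAlg.z a := fun a => OkuboAlg.ext fun c => by
    rw [hφc, OkuboAlg.coord_z, Module.Basis.repr_self, Finsupp.single_apply]
    simp only [eq_comm]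
  refine ⟨φ, ?_, ?_⟩
  · have : (LinearMap.mul F O).compr₂ (φ : O →ₗ[F] OkuboAlg F α β)
        = (LinearMap.mul F (OkuboAlg F α β)).compl₁₂ (φ : O →ₗ[F] OkuboAlg F α β)
          (φ : O →ₗ[F] OkuboAlg F α β) := by
      refine b.ext fun i => b.ext fun j => OkuboAlg.ext fun c => ?_
      simp only [LinearMap.compr₂_apply, LinearMap.mul_apply', LinearMap.compl₁₂_apply,
        LinearEquiv.coe_coe, hφ, OkuboAlg.z_mul_z]
      rw [hb, hb, table, map_smul, map_smul, smul_eq_mul]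
      by_cases hij : i.val + j.val = 0
      · have : sgn i.val j.val = 0 := if_pos (Or.inr hij)
        simp [this]
      · have : canonicalFamily e f (i.val + j.val) = b ⟨_, hij⟩ :=
          (hb ⟨i.val + j.val, hij⟩).symm
        rw [this, hφ, OkuboAlg.coord_z]
        simp only [Subtype.ext_iff, eq_comm, mul_ite, mul_one, mul_zero]
    intro x y
    exact LinearMap.congr_fun₂ this x y
  · intro g hg
    -- The basis lies in the components of degrees `D a`. A component of any other degree would be
    -- independent of a family that already spans, so it is zero.
    obtain ⟨a, rfl⟩ : ∃ a : Idx, D a.val = g := by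
      by_contra! hcon
      refine hg (eq_bot_iff.2 ?_)
      have h1 : (⊤ : Submodule F O) ≤ ⨆ (k) (_ : k ≠ g), Γ.comp k := by
        rw [← b.span_eq, Submodule.span_le]
        rintro _ ⟨a, rfl⟩
        rw [hb]
        exact Submodule.mem_iSup_of_mem (D a.val) (Submodule.mem_iSup_of_mem (hcon a) (hmem a.val))
      exact (Γ.isInternal.submodule_iSupIndep g) le_rfl (le_top.trans h1)
    refine ⟨a.val, ?_⟩
    have hs : Γ.comp (D a.val) = Submodule.span F {b a} := by
      refine le_antisymm (fun y hy => ?_) ?_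
      · obtain ⟨t, rfl⟩ := hO.exists_smul_eq hΓ (hmem a.val) hy (hne a)
        rw [← hb]
        exact Submodule.smul_mem _ _ (Submodule.mem_span_singleton_self _)
      · rw [Submodule.span_singleton_le_iff_mem, hb]
        exact hmem a.val
    rw [hs, Submodule.map_span, Set.image_singleton]
    change _ = canonicalComp α β a.val
    rw [canonicalComp]
    congr 1
    have : {i : Idx | i.val = a.val} = {a} := by ext i; simp [Subtype.ext_iff]
    rw [this, Set.image_singleton, LinearEquiv.coe_coe, hφ]

end Okubo

theorem mainTheorem5 {F : Type*} [Field F]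
    {O : Type*} [NonUnitalNonAssocRing O] [Module F O] [IsScalarTower F O O] [SMulCommClass F O O]
    (n : QuadraticForm F O) (hO : Okubo.IsOkuboAlgebra F O n)
    {G : Type*} [AddCommGroup G] [DecidableEq G]
    (Γ : Okubo.Grading F G O) (hΓ : Γ.IsSpecial) :
    ∃ α β : F, α ≠ 0 ∧ β ≠ 0 ∧ Γ.Equivalent (Okubo.canonicalGrading α β) := by
  have hn := hO.isSymmComp
  obtain ⟨g, h, x, hx, w, hw, hx0, hw0, hgh, hgh'⟩ := hO.exists_independent hΓ
  obtain ⟨g, h, x, hx, w, hw, hx0, hw0, hgh, hgh', hwx⟩ : ∃ g h : G, ∃ x ∈ Γ.comp g,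
      ∃ w ∈ Γ.comp h, x ≠ 0 ∧ w ≠ 0 ∧ h ≠ g ∧ h ≠ -g ∧ w * x = 0 := by
    -- The hypotheses on the degrees are symmetric, so the two elements may be swapped to put the
    -- vanishing product in the order `w * x`.
    rcases hO.mul_eq_zero_or hΓ hx hw hx0 hgh hgh' with h0 | h0
    · exact ⟨h, g, w, hw, x, hx, hw0, hx0, hgh.symm, fun h1 => hgh' (by rw [h1, neg_neg]), h0⟩
    · exact ⟨g, h, x, hx, w, hw, hx0, hw0, hgh, hgh', h0⟩
  have hg := hΓ.three_nsmul_eq_zero hn hx hx0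
  have hh := hΓ.three_nsmul_eq_zero hn hw hw0
  have hg0 : g ≠ 0 := by
    rintro rfl
    rw [hΓ, Submodule.mem_bot] at hx
    exact hx0 hx
  have hh0 : h ≠ 0 := by
    rintro rfl
    rw [hΓ, Submodule.mem_bot] at hw
    exact hw0 hw
  rw [← Okubo.degreeHom_one_zero hg hh] at hx
  rw [← Okubo.degreeHom_zero_one hg hh] at hw
  exact ⟨_, _, hΓ.polar_mul_self_ne_zero hn hx hx0, hΓ.polar_mul_self_ne_zero hn hw hw0,
    hO.equivalent_canonicalGrading hΓ (Okubo.degreeHom_injective hg hh hg0 hh0 hgh hgh') hx hw hx0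
      hw0 hwx rfl rfl⟩
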